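/- \textbf{Setting.} An agent has a private type $\theta\in\Theta=[\underline\theta,\bar\theta]$, $0\le\underline\theta<\bar\theta$, with distribution function $F$ and continuous density $f>0$ on $\Theta$. He chooses a quality $q\in Q=[0,q_{\max}]$ at cost $c(q)/\theta$, where $c$ is twice continuously differentiable on $Q$, $c(0)=c'(0)=0$, $c'(q)>0$ for $q>0$, $c''\ge 0$, and $q_{\max}>0$ satisfies $c(q_{\max})\ge\bar\theta q_{\max}$. The principal commits to a deterministic rating $\pi\colon Q\to S$, where $S$ is an arbitrary set of scores. The agent chooses $q$ and whether to take the test; the market observes the score $\pi(q)$, or a null signal if the test is not taken, and pays a wage equal to the conditional expectation of $q$ given what it observes. The agent maximizes wage minus cost, equivalently $\theta\cdot\text{wage}-c(q)$ (which is used as his payoff also for $\theta=0$). A quality scheme $q\colon\Theta\to Q$ is implemented by $\pi$ if it arises in an equilibrium (optimal choices of all types, beliefs given by Bayes' rule on path and compatible with the score off path). A deterministic rating is optimal if it implements a scheme $q$ that maximizes $\int_\Theta v(q(\theta),\theta)\,dF(\theta)$ among all schemes implemented by any deterministic rating. For $q_0\in Q$, \emph{lower censorship} with minimum standard $q_0$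 is the rating that reveals $q$ if $q\ge q_0$ and gives ``fail'' otherwise; the \emph{pass/fail test} with minimum standard $q_0$ gives ``pass'' if $q\ge q_0$ and ``fail'' otherwise. Lower censorship is \emph{without exclusion} if its cutoff type $c(q_0)/q_0$ (read as $0$ if $q_0=0$) is at most $\underline\theta$ and every type $\theta>0$ in $\Theta$ chooses a positive quality. Linear delegation means $v(q,\theta)=\beta(\theta)q-\alpha c(q)+d(\theta)$ with $\alpha\ge0$, $\beta$ and $d$ continuous on $\Theta$, and $\beta(\theta)\ge\alpha\theta$ for all $\theta\in\Theta$. For a real number $\theta_0$, put $$r(\theta)=(\beta(\theta)-\alpha\theta)f(\theta)-\alpha\,(F(\theta)-F(\theta_0)),\qquad \theta\in\Theta .$$ The choice of $\theta_0$ only changes $r$ by an additive constant. \textbf{Statement.} Assume linear delegation, and let $\theta_0$ be arbitrary (so that no optimal cutoff needs to be known). \begin{enumerate} \item If $r$ is unimodal on $\Theta$ (weakly increasing up to some $\theta_m\in\Theta$ and weakly decreasing from $\theta_m$ on), then lower censorship with some minimum standard $q_0\in Q$ is an optimal deterministic rating. \item If $r$ is weakly increasing on $\Theta$, then a pass/fail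 test with some minimum standard $q_0\in Q$ is an optimal deterministic rating. \item If $r$ is weakly decreasing on $\Theta$, then lower censorship without exclusion, with some minimum standard $q_0\in Q$, is an optimal deterministic rating. \end{enumerate} -/

import Mathlib

open Set MeasureTheory

noncomputable section

/-- The primitives of the rating model. Types lie in `Θ = [lo, hi]` and have a continuous positive
density `f` on `Θ`. Qualities lie in `Q = [0, qmax]`, and quality `q` costs type `θ` the amount
`c q / θ`, where `c` is twice continuously differentiable with `c(0) = c'(0) = 0`, `c' > 0` on
`(0, qmax]` and `c'' ≥ 0`. The set `Q` is large enough for the highest type: it contains the quality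
at which the average cost `c(q) / q` equals `hi`. -/
structure RatingModel where
  lo : ℝ
  hi : ℝ
  qmax : ℝ
  f : ℝ → ℝ
  c : ℝ → ℝ
  lo_nonneg : 0 ≤ lo
  lo_lt_hi : lo < hi
  f_continuousOn : ContinuousOn f (Icc lo hi)
  f_pos : ∀ θ ∈ Icc lo hi, 0 < f θ
  f_integral : ∫ θ in lo..hi, f θ = 1
  qmax_pos : 0 < qmax
  c_contDiffOn : ContDiffOn ℝ 2 c (Icc 0 qmax)
  c_zero : c 0 = 0
  c_deriv_zero : derivWithin c (Icc 0 qmax) 0 = 0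
  c_deriv_pos : ∀ q ∈ Ioc 0 qmax, 0 < derivWithin c (Icc 0 qmax) q
  c_deriv2_nonneg : ∀ q ∈ Icc 0 qmax, 0 ≤ iteratedDerivWithin 2 c (Icc 0 qmax) q
  qmax_large : hi * qmax ≤ c qmax

namespace RatingModel

variable (M : RatingModel)

/-- The type space `Θ`. -/
def types : Set ℝ := Icc M.lo M.hi

/-- The set `Q` of feasible qualities. -/
def qualities : Set ℝ := Icc 0 M.qmax

/-- The distribution of types. -/
def typeDist : Measure ℝ :=
  (volume.restrict (Icc M.lo M.hi)).withDensity (fun θ => ENNReal.ofReal (M.f θ))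

/-- The distribution function `F`, on all of `ℝ`. -/
def F (θ : ℝ) : ℝ := M.typeDist.real (Iic θ)

/-- The density of types, extended by zero outside `Θ`. -/
def density : ℝ → ℝ := (Icc M.lo M.hi).indicator M.f

/-- The payoff of type `θ` from quality `q` and wage `w`, that is `w - c(q) / θ`, multiplied by `θ`.
For `θ = 0` this is the usual convention that the lowest type only cares about the cost. -/
def agentPayoff (w q θ : ℝ) : ℝ := θ * w - M.c q

/-- What the market observes when quality is `q`: the score if the test is taken, and the null
signal `none` otherwise. -/
def signal {S : Type} (π : ℝ → S) (takes : Bool) (q : ℝ) : Option S :=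
  if takes then some (π q) else none

/-- `IsEquilibrium π q takes belief wage`: under the deterministic rating `π` (only its values on `Q`
matter), types choose qualities `q θ` and participation `takes θ`, and the market holds beliefs
`belief s` about quality after each signal `s` and pays wages `wage s`, in equilibrium. -/
structure IsEquilibrium {S : Type} (π : ℝ → S) (q : ℝ → ℝ) (takes : ℝ → Bool)
    (belief : Option S → Measure ℝ) (wage : Option S → ℝ) : Prop where
  /-- chosen qualities are feasible -/
  mem_qualities : ∀ θ ∈ M.types, q θ ∈ M.qualities
  /-- no type gains by another quality or participation decision -/
  optimal : ∀ θ ∈ M.types, ∀ q' ∈ M.qualities, ∀ t' : Bool,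
    M.agentPayoff (wage (signal π t' q')) q' θ
      ≤ M.agentPayoff (wage (signal π (takes θ) (q θ))) (q θ) θ
  /-- beliefs are probability distributions -/
  belief_prob : ∀ s, IsProbabilityMeasure (belief s)
  /-- after any possible score, the market knows that quality is one that gets this score -/
  belief_score : ∀ s ∈ π '' M.qualities, ∀ᵐ x ∂(belief (some s)), x ∈ M.qualities ∧ π x = s
  /-- after the null signal, quality can be anything feasible -/
  belief_null : ∀ᵐ x ∂(belief none), x ∈ M.qualities
  /-- after a signal sent by some type, quality is that of a type who sends it -/
  belief_onPath : ∀ s, (∃ θ ∈ M.types, signal π (takes θ) (q θ) = s) →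
    ∀ᵐ x ∂(belief s), ∃ θ ∈ M.types, signal π (takes θ) (q θ) = s ∧ q θ = x
  /-- Bayes' rule: `belief` is the conditional distribution of quality given the signal -/
  bayes : ∀ (B : Set (Option S)) (A : Set ℝ), MeasurableSet A →
    MeasurableSet {θ | θ ∈ M.types ∧ signal π (takes θ) (q θ) ∈ B} →
    ∫⁻ θ in {θ | θ ∈ M.types ∧ signal π (takes θ) (q θ) ∈ B},
        belief (signal π (takes θ) (q θ)) A ∂M.typeDist
      = M.typeDist {θ | (θ ∈ M.types ∧ signal π (takes θ) (q θ) ∈ B) ∧ q θ ∈ A}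
  /-- the competitive market pays the expected quality -/
  wage_eq : ∀ s, wage s = ∫ x, x ∂(belief s)

/-- The quality scheme `q` is implementable by the deterministic rating `π`. -/
def Implements {S : Type} (π : ℝ → S) (q : ℝ → ℝ) : Prop :=
  ∃ takes belief wage, M.IsEquilibrium π q takes belief wage

/-- The principal's expected payoff from a quality scheme, with utility `v q θ`. -/
def principalPayoff (v : ℝ → ℝ → ℝ) (q : ℝ → ℝ) : ℝ := ∫ θ, v (q θ) θ ∂M.typeDist

/-- The deterministic rating `π`, implementing `q`, is optimal among all deterministic ratings. A
deterministic rating is a partition of `Q` into scores, so score sets in `Type` are enough. -/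
def IsOptimalRating (v : ℝ → ℝ → ℝ) {S : Type} (π : ℝ → S) (q : ℝ → ℝ) : Prop :=
  M.Implements π q ∧
    ∀ (S' : Type) (π' : ℝ → S') (q' : ℝ → ℝ), M.Implements π' q' →
      M.principalPayoff v q' ≤ M.principalPayoff v q

/-- The cutoff type of a minimum standard `q₀`: its average cost (`0` if `q₀ = 0`). -/
def cutoffType (q₀ : ℝ) : ℝ := M.c q₀ / q₀

/-- There is no exclusion in the scheme `q` induced by the minimum standard `q₀`: the cutoff type is
at most the lowest type, and no type chooses quality zero (except type `0`, if present, for whom any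
positive quality is infinitely costly). -/
def NoExclusion (q₀ : ℝ) (q : ℝ → ℝ) : Prop :=
  M.cutoffType q₀ ≤ M.lo ∧ ∀ θ ∈ M.types, 0 < θ → 0 < q θ

/-- Linear delegation: `v(q, θ) = β(θ) q - α c(q) + d(θ)`, with `α ≥ 0` and downward bias
`β(θ) ≥ α θ`. -/
structure LinearDelegation (v : ℝ → ℝ → ℝ) (α : ℝ) (β d : ℝ → ℝ) : Prop where
  alpha_nonneg : 0 ≤ α
  beta_continuousOn : ContinuousOn β M.types
  d_continuousOn : ContinuousOn d M.types
  downward_bias : ∀ θ ∈ M.types, α * θ ≤ β θ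
  eq : ∀ q ∈ M.qualities, ∀ θ ∈ M.types, v q θ = β θ * q - α * M.c q + d θ

/-- The characteristic function
`r(θ) = (β(θ) - α θ) f(θ) - α (F(θ) - F(θ₀))`. -/
def r (α : ℝ) (β : ℝ → ℝ) (θ₀ θ : ℝ) : ℝ :=
  (β θ - α * θ) * M.density θ - α * (M.F θ - M.F θ₀)

end RatingModel

/-- Lower censorship with minimum standard `q₀`: reveal `q` if `q ≥ q₀`, and "fail" (`none`)
otherwise. -/
def lowerCensorship (q₀ q : ℝ) : Option ℝ :=
  open Classical in if q₀ ≤ q then some q else none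

/-- The pass/fail test with minimum standard `q₀` (`true` is "pass"). -/
def passFail (q₀ q : ℝ) : Bool :=
  open Classical in decide (q₀ ≤ q)

/-- `g` is unimodal on `s`: increasing up to some mode `m ∈ s` and decreasing afterwards (weakly). -/
def UnimodalOn (g : ℝ → ℝ) (s : Set ℝ) : Prop :=
  ∃ m ∈ s, MonotoneOn g (s ∩ Iic m) ∧ AntitoneOn g (s ∩ Ici m)

end

/-! Types that send the same signal receive the same wage, so in equilibrium they bear the same cost
and choose the same quality. Every wage on path is therefore the quality itself
(`Implements.incentiveCompatible`), and an implementable scheme amounts to free choice from a menu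
of qualities. Its indirect utility `U(θ) = θ q(θ) - c(q(θ))` is nonnegative and has `q` as a
subgradient.

Let `p = (β - αθ) f`, so that `r = p - αF` up to a constant, and let `δ` be the change in `U`
between two schemes. The principal's gain is `∫ (p δ' + α δ f)`, which by parts is the boundary term
of `p δ` minus `∫ δ dr`. If `δ ≤ 0` left of the mode `m` and `δ ≥ 0` right of it, then `-∫ δ dr ≥
0`; the boundary terms are nonnegative because downward bias gives `p ≥ 0` (`principalPayoff_le`).

Such a rotation is always available. Take the largest quality `q₀` that leaves type `m` as well off
as under the given scheme (`exists_indifferent_standard`) and impose it as a minimum standard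
(`principalPayoff_le_of_standard`). Thus only minimum standards compete, and the payoff is
continuous in the standard, so a best one exists by compactness (`exists_isOptimalRating`). For
increasing `r` the mode is the highest type, and nothing above `q₀` is needed; for decreasing `r` it
is the lowest type, who is willing to meet `q₀`, so nobody is excluded. -/

/-! ### Integration by parts and the envelope formula for monotone functions. -/

/-- A function whose decrease over each subinterval is bounded by the length of the subinterval
times the increment of a fixed function does not decrease at all. -/
lemma le_of_sub_le_mul_sub {Φ G : ℝ → ℝ} {a b : ℝ} (hab : a ≤ b)
    (h : ∀ x y, a ≤ x → x ≤ y → y ≤ b → Φ x - Φ y ≤ (y - x) * (G y - G x)) : Φ a ≤ Φ b := by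
  -- On a partition into `n` equal pieces the increments of `G` telescope, so the total error is
  -- `O(1/n)`.
  have key : ∀ n : ℕ, 0 < n → Φ a - Φ b ≤ (b - a) * (G b - G a) / n := by
    intro n hn
    have hn' : (0 : ℝ) < n := by exact_mod_cast hn
    set x : ℕ → ℝ := fun i => a + (b - a) * (i / n) with hx
    have hx0 : x 0 = a := by simp [hx]
    have hxn : x n = b := by simp [hx, div_self hn'.ne']
    have hstep : ∀ i, x (i + 1) - x i = (b - a) / n := by
      intro i; simp only [hx]; push_cast; field_simp; ring
    have hsum : ∑ i ∈ Finset.range n, (Φ (x (i + 1)) - Φ (x i)) = Φ b - Φ a := by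
      rw [Finset.sum_range_sub (fun i => Φ (x i)), hx0, hxn]
    have hsumG : ∑ i ∈ Finset.range n, (G (x (i + 1)) - G (x i)) = G b - G a := by
      rw [Finset.sum_range_sub (fun i => G (x i)), hx0, hxn]
    have hle : ∑ i ∈ Finset.range n, -((b - a) / n * (G (x (i + 1)) - G (x i)))
        ≤ ∑ i ∈ Finset.range n, (Φ (x (i + 1)) - Φ (x i)) := by
      refine Finset.sum_le_sum fun i hi => ?_
      have hi' : ((i : ℝ) + 1) ≤ n := by exact_mod_cast Finset.mem_range.1 hi
      have h1 : a ≤ x i := by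
        have : 0 ≤ (b - a) * (i / n) := mul_nonneg (sub_nonneg.2 hab) (by positivity)
        simp only [hx]; linarith
      have h2 : x i ≤ x (i + 1) := by
        have := hstep i
        have : 0 ≤ (b - a) / n := div_nonneg (sub_nonneg.2 hab) hn'.le
        linarith
      have h3 : x (i + 1) ≤ b := by
        have h4 : ((i + 1 : ℕ) : ℝ) / n ≤ 1 := by
          rw [div_le_one hn']; push_cast; exact hi'
        have := mul_le_mul_of_nonneg_left h4 (sub_nonneg.2 hab)
        simp only [hx]; linarith
      have := h _ _ h1 h2 h3
      rw [hstep] at this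
      linarith
    rw [hsum, Finset.sum_neg_distrib, ← Finset.mul_sum, hsumG] at hle
    have : (b - a) / n * (G b - G a) = (b - a) * (G b - G a) / n := by ring
    linarith
  have hlim : Filter.Tendsto (fun n : ℕ => (b - a) * (G b - G a) / n) Filter.atTop (nhds 0) :=
    tendsto_const_div_atTop_nhds_zero_nat _
  have := ge_of_tendsto hlim
    (Filter.eventually_atTop.2 ⟨1, fun n hn => key n hn⟩)
  linarith

/-- A lower bound on `∫ p δ' + α δ f`, by integration by parts against `s = p - α ∫ f`, when `s` is
monotone (its variation is controlled by `G`) in the direction opposite to the sign of `δ`. -/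
lemma boundary_le_integral {p s g δ f F G : ℝ → ℝ} {a b α K C : ℝ} (hab : a ≤ b) (hα : 0 ≤ α)
    (hps : ∀ x ∈ Icc a b, ∀ y ∈ Icc a b, p y - p x = s y - s x + α * (F y - F x))
    (hF : ∀ x y, a ≤ x → x ≤ y → y ≤ b → F y - F x = ∫ t in x..y, f t)
    (hδ : ∀ x y, a ≤ x → x ≤ y → y ≤ b → δ y - δ x = ∫ t in x..y, g t)
    (hf : ContinuousOn f (Icc a b)) (hfC : ∀ x ∈ Icc a b, 0 ≤ f x ∧ f x ≤ C)
    (hp : ContinuousOn p (Icc a b)) (hg : IntervalIntegrable g volume a b)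
    (hgK : ∀ x ∈ Icc a b, |g x| ≤ K)
    (hsG : ∀ x y, a ≤ x → x ≤ y → y ≤ b → |s y - s x| ≤ G y - G x)
    (hsδ : ∀ x y, a ≤ x → x ≤ y → y ≤ b → (s y - s x) * δ x ≤ 0) :
    p b * δ b - p a * δ a ≤ ∫ t in a..b, (p t * g t + α * (δ t * f t)) := by
  have hK : 0 ≤ K := (abs_nonneg _).trans (hgK a ⟨le_rfl, hab⟩)
  have hC : 0 ≤ C := (hfC a ⟨le_rfl, hab⟩).1.trans (hfC a ⟨le_rfl, hab⟩).2
  have sub : ∀ x y, a ≤ x → x ≤ y → y ≤ b → uIcc x y ⊆ Icc a b := fun x y h1 h2 h3 => by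
    rw [uIcc_of_le h2]; exact Icc_subset_Icc h1 h3
  have hδlip : ∀ x y, a ≤ x → x ≤ y → y ≤ b → |δ y - δ x| ≤ K * (y - x) := by
    intro x y h1 h2 h3
    rw [hδ x y h1 h2 h3]
    have := intervalIntegral.norm_integral_le_of_norm_le_const (a := x) (b := y) (f := g) (C := K)
      (fun t ht => by
        rw [uIoc_of_le h2] at ht
        exact hgK t ⟨h1.trans ht.1.le, ht.2.trans h3⟩)
    rwa [abs_of_nonneg (sub_nonneg.2 h2)] at this
  have hδc : ContinuousOn δ (Icc a b) := by
    refine (LipschitzOnWith.of_dist_le_mul (K := K.toNNReal) fun x hx y hy => ?_).continuousOn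
    rw [Real.coe_toNNReal _ hK, Real.dist_eq, Real.dist_eq]
    rcases le_total x y with h | h
    · rw [abs_sub_comm, abs_sub_comm x y, abs_of_nonneg (sub_nonneg.2 h)]
      exact hδlip x y hx.1 h hy.2
    · rw [abs_of_nonneg (sub_nonneg.2 h)]
      exact hδlip y x hy.1 h hx.2
  have hFmono : ∀ x y, a ≤ x → x ≤ y → y ≤ b → 0 ≤ F y - F x := by
    intro x y h1 h2 h3
    rw [hF x y h1 h2 h3]
    exact intervalIntegral.integral_nonneg h2 fun t ht => (hfC t ⟨h1.trans ht.1, ht.2.trans h3⟩).1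
  have gi : ∀ x y, a ≤ x → x ≤ y → y ≤ b → IntervalIntegrable g volume x y :=
    fun x y h1 h2 h3 => hg.mono_set (by rw [uIcc_of_le hab]; exact sub x y h1 h2 h3)
  have fi : ∀ x y, a ≤ x → x ≤ y → y ≤ b → IntervalIntegrable f volume x y :=
    fun x y h1 h2 h3 => (hf.mono (sub x y h1 h2 h3)).intervalIntegrable
  have pgi : ∀ x y, a ≤ x → x ≤ y → y ≤ b →
      IntervalIntegrable (fun t => p t * g t) volume x y := fun x y h1 h2 h3 =>
    (gi x y h1 h2 h3).continuousOn_mul (hp.mono (sub x y h1 h2 h3))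
  have dfi : ∀ x y, a ≤ x → x ≤ y → y ≤ b →
      IntervalIntegrable (fun t => α * (δ t * f t)) volume x y := fun x y h1 h2 h3 =>
    (((hδc.mul hf).mono (sub x y h1 h2 h3)).intervalIntegrable).const_mul α
  set k : ℝ → ℝ := fun t => p t * g t + α * (δ t * f t) with hk
  have ki : ∀ x y, a ≤ x → x ≤ y → y ≤ b → IntervalIntegrable k volume x y :=
    fun x y h1 h2 h3 => (pgi x y h1 h2 h3).add (dfi x y h1 h2 h3)
  -- No derivative of `s` is available, so the inequality is proved by local estimates: over `[x,
  -- y]` the function `Φ` decreases by at most `y - x` times an increment of `G`, here `K` times the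
  -- joint variation of `s`, `αF` and `αC · id`.
  have main := le_of_sub_le_mul_sub (Φ := fun x => (∫ t in a..x, k t) - p x * δ x)
    (G := fun x => K * (G x + α * F x + α * C * x)) hab (by
      intro x y h1 h2 h3
      have hxy : (∫ t in a..y, k t) - ∫ t in a..x, k t = ∫ t in x..y, k t :=
        intervalIntegral.integral_interval_sub_left (ki a y le_rfl (h1.trans h2) h3)
          (ki a x le_rfl h1 (h2.trans h3))
      have hx : x ∈ Icc a b := ⟨h1, h2.trans h3⟩
      have hy : y ∈ Icc a b := ⟨h1.trans h2, h3⟩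
      -- Freezing `p` at the right end and `δ` at the left end leaves exactly `(p y - p x) * δ x`
      -- from the increment of `p δ`. Its `αF` part cancels, and its `s` part has the sign given by
      -- `hsδ`.
      have e1 : ∫ t in x..y, k t = (∫ t in x..y, ((p t - p y) * g t + α * ((δ t - δ x) * f t)))
          + p y * (δ y - δ x) + α * δ x * (F y - F x) := by
        rw [hδ x y h1 h2 h3, hF x y h1 h2 h3, ← intervalIntegral.integral_const_mul,
          ← intervalIntegral.integral_const_mul]
        have i1 : IntervalIntegrable (fun t => (p t - p y) * g t + α * ((δ t - δ x) * f t))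
            volume x y := by
          have := ((pgi x y h1 h2 h3).sub ((gi x y h1 h2 h3).const_mul (p y))).add
            ((dfi x y h1 h2 h3).sub ((fi x y h1 h2 h3).const_mul (α * δ x)))
          refine this.congr (fun t _ => ?_)
          ring
        rw [← intervalIntegral.integral_add i1 ((gi x y h1 h2 h3).const_mul _),
          ← intervalIntegral.integral_add (i1.add ((gi x y h1 h2 h3).const_mul _))
            ((fi x y h1 h2 h3).const_mul _)]
        refine intervalIntegral.integral_congr fun t _ => ?_
        simp only [hk]
        ring
      have e2 : ‖∫ t in x..y, ((p t - p y) * g t + α * ((δ t - δ x) * f t))‖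
          ≤ (K * (G y - G x + α * (F y - F x) + α * C * (y - x))) * |y - x| := by
        refine intervalIntegral.norm_integral_le_of_norm_le_const fun t ht => ?_
        rw [uIoc_of_le h2] at ht
        have hat : a ≤ t := h1.trans ht.1.le
        have htb : t ≤ b := ht.2.trans h3
        have b1 : |p t - p y| ≤ (G y - G x) + α * (F y - F x) := by
          rw [abs_sub_comm, hps t ⟨hat, htb⟩ y hy]
          have c1 := hsG t y hat ht.2 h3
          have c2 := hsG x t h1 ht.1.le htb
          have c3 := hFmono x t h1 ht.1.le htb
          have c4 := hFmono t y hat ht.2 h3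
          have c5 := abs_nonneg (s t - s x)
          have c6 : α * (F y - F t) ≤ α * (F y - F x) :=
            mul_le_mul_of_nonneg_left (by linarith) hα
          calc |s y - s t + α * (F y - F t)| ≤ |s y - s t| + |α * (F y - F t)| := abs_add_le _ _
            _ = |s y - s t| + α * (F y - F t) := by rw [abs_of_nonneg (mul_nonneg hα c4)]
            _ ≤ _ := by linarith
        have b2 : |δ t - δ x| ≤ K * (y - x) :=
          (hδlip x t h1 ht.1.le htb).trans (mul_le_mul_of_nonneg_left (by linarith [ht.2]) hK)
        have b3 := hgK t ⟨hat, htb⟩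
        have b4 := hfC t ⟨hat, htb⟩
        have b5 : |f t| ≤ C := by rw [abs_of_nonneg b4.1]; exact b4.2
        calc ‖(p t - p y) * g t + α * ((δ t - δ x) * f t)‖
            ≤ |(p t - p y) * g t| + |α * ((δ t - δ x) * f t)| := abs_add_le _ _
          _ = |p t - p y| * |g t| + α * (|δ t - δ x| * |f t|) := by
              rw [abs_mul, abs_mul, abs_mul, abs_of_nonneg hα]
          _ ≤ ((G y - G x) + α * (F y - F x)) * K + α * (K * (y - x) * C) := by
              gcongr
              · exact (abs_nonneg _).trans b1
          _ = _ := by ring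
      rw [Real.norm_eq_abs, abs_of_nonneg (sub_nonneg.2 h2)] at e2
      have e3 := hsδ x y h1 h2 h3
      have e4 := hps x hx y hy
      have e5 := (abs_le.1 e2).1
      have e6 : (p y - p x) * δ x = (s y - s x) * δ x + α * δ x * (F y - F x) := by
        rw [e4]; ring
      have e7 : (∫ t in a..x, k t) - p x * δ x - ((∫ t in a..y, k t) - p y * δ y)
        = -(∫ t in x..y, k t) + p y * (δ y - δ x) + (p y - p x) * δ x := by
        rw [← hxy]; ring
      rw [e7, e6, e1]
      linarith)
  simp only [intervalIntegral.integral_same] at main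
  linarith

/-- The envelope formula: if `q` is a subgradient of `U`, then `U` is an integral of `q`. -/
lemma sub_eq_integral_of_subgradient {U q : ℝ → ℝ} {a b : ℝ} (hab : a ≤ b)
    (hU : ∀ x ∈ Icc a b, ∀ y ∈ Icc a b, (y - x) * q x ≤ U y - U x)
    (hq : MonotoneOn q (Icc a b)) : U b - U a = ∫ t in a..b, q t := by
  have sub : ∀ x y, a ≤ x → x ≤ y → y ≤ b → uIcc x y ⊆ Icc a b := fun x y h1 h2 h3 => by
    rw [uIcc_of_le h2]; exact Icc_subset_Icc h1 h3
  have qi : ∀ x y, a ≤ x → x ≤ y → y ≤ b → IntervalIntegrable q volume x y :=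
    fun x y h1 h2 h3 => (hq.mono (sub x y h1 h2 h3)).intervalIntegrable
  have est : ∀ x y, a ≤ x → x ≤ y → y ≤ b →
      (y - x) * q x ≤ ∫ t in x..y, q t ∧ ∫ t in x..y, q t ≤ (y - x) * q y := by
    intro x y h1 h2 h3
    have hx : x ∈ Icc a b := ⟨h1, h2.trans h3⟩
    have hy : y ∈ Icc a b := ⟨h1.trans h2, h3⟩
    have c : ∀ z : ℝ, ∫ _t in x..y, z = (y - x) * z := fun z => by simp
    rw [← c, ← c]
    exact ⟨intervalIntegral.integral_mono_on h2 (by simp) (qi x y h1 h2 h3)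
        fun t ht => hq hx ⟨h1.trans ht.1, ht.2.trans h3⟩ ht.1,
      intervalIntegral.integral_mono_on h2 (qi x y h1 h2 h3) (by simp)
        fun t ht => hq ⟨h1.trans ht.1, ht.2.trans h3⟩ hy ht.2⟩
  have add : ∀ x y, a ≤ x → x ≤ y → y ≤ b →
      (∫ t in a..y, q t) - ∫ t in a..x, q t = ∫ t in x..y, q t := fun x y h1 h2 h3 =>
    intervalIntegral.integral_interval_sub_left (qi a y le_rfl (h1.trans h2) h3)
      (qi a x le_rfl h1 (h2.trans h3))
  -- The increments of `U` and of the integral both lie between `(y - x) * q x` and `(y - x) * q y`;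
  -- this bounds their difference in both directions.
  have m1 := le_of_sub_le_mul_sub (Φ := fun x => U x - ∫ t in a..x, q t) (G := q) hab (by
    intro x y h1 h2 h3
    have := hU x ⟨h1, h2.trans h3⟩ y ⟨h1.trans h2, h3⟩
    have := est x y h1 h2 h3
    have := add x y h1 h2 h3
    linarith)
  have m2 := le_of_sub_le_mul_sub (Φ := fun x => (∫ t in a..x, q t) - U x) (G := q) hab (by
    intro x y h1 h2 h3
    have := hU y ⟨h1.trans h2, h3⟩ x ⟨h1, h2.trans h3⟩
    have := est x y h1 h2 h3
    have := add x y h1 h2 h3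
    linarith)
  simp only [intervalIntegral.integral_same] at m1 m2
  linarith

/-! ### Basic properties of the model and the cost function. -/

namespace RatingModel

variable (M : RatingModel)

lemma zero_mem_qualities : 0 ∈ M.qualities := ⟨le_rfl, M.qmax_pos.le⟩

lemma qmax_mem_qualities : M.qmax ∈ M.qualities := ⟨M.qmax_pos.le, le_rfl⟩

lemma hi_mem_types : M.hi ∈ M.types := ⟨M.lo_lt_hi.le, le_rfl⟩

lemma lo_mem_types : M.lo ∈ M.types := ⟨le_rfl, M.lo_lt_hi.le⟩

lemma types_nonneg {θ : ℝ} (hθ : θ ∈ M.types) : 0 ≤ θ := M.lo_nonneg.trans hθ.1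

lemma isCompact_qualities : IsCompact M.qualities := isCompact_Icc

lemma c_continuousOn : ContinuousOn M.c M.qualities := M.c_contDiffOn.continuousOn

lemma deriv_c {x : ℝ} (hx : x ∈ interior (Icc 0 M.qmax)) :
    deriv M.c x = derivWithin M.c (Icc 0 M.qmax) x :=
  (derivWithin_of_mem_nhds (mem_interior_iff_mem_nhds.1 hx)).symm

lemma c_strictMonoOn : StrictMonoOn M.c M.qualities :=
  strictMonoOn_of_deriv_pos (convex_Icc 0 M.qmax) M.c_continuousOn fun x hx => by
    rw [M.deriv_c hx]
    rw [interior_Icc] at hx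
    exact M.c_deriv_pos x ⟨hx.1, hx.2.le⟩

lemma c_convexOn : ConvexOn ℝ M.qualities M.c := by
  have hu : UniqueDiffOn ℝ (Icc 0 M.qmax) := uniqueDiffOn_Icc M.qmax_pos
  have hd : DifferentiableOn ℝ (derivWithin M.c (Icc 0 M.qmax)) (Icc 0 M.qmax) :=
    (M.c_contDiffOn.derivWithin hu (m := 1) (by norm_num)).differentiableOn (by norm_num)
  have hm : MonotoneOn (derivWithin M.c (Icc 0 M.qmax)) (Icc 0 M.qmax) := by
    refine monotoneOn_of_deriv_nonneg (convex_Icc _ _) hd.continuousOn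
      (hd.mono interior_subset) fun x hx => ?_
    have h := M.c_deriv2_nonneg x (interior_subset hx)
    rw [show (2 : ℕ) = 1 + 1 from rfl, iteratedDerivWithin_succ,
      derivWithin_congr (f := derivWithin M.c (Icc 0 M.qmax)) (fun y _ => by
        rw [iteratedDerivWithin_one]) (by rw [iteratedDerivWithin_one]),
      derivWithin_of_mem_nhds (mem_interior_iff_mem_nhds.1 hx)] at h
    exact h
  refine MonotoneOn.convexOn_of_deriv (convex_Icc 0 M.qmax) M.c_continuousOn
    ((M.c_contDiffOn.differentiableOn (by norm_num)).mono interior_subset) ?_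
  intro x hx y hy hxy
  rw [M.deriv_c hx, M.deriv_c hy]
  exact hm (interior_subset hx) (interior_subset hy) hxy

lemma c_nonneg {q : ℝ} (hq : q ∈ M.qualities) : 0 ≤ M.c q := by
  rw [← M.c_zero]
  exact M.c_strictMonoOn.monotoneOn M.zero_mem_qualities hq hq.1

/-- For a positive type, small positive qualities are worth their cost. -/
lemma eventually_c_lt {θ : ℝ} (hθ : 0 < θ) :
    ∀ᶠ q in nhdsWithin 0 M.qualities, 0 < q → M.c q < θ * q := by
  have hd : HasDerivWithinAt M.c 0 (Icc 0 M.qmax) 0 := by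
    have := (M.c_contDiffOn.differentiableOn (by norm_num) 0 M.zero_mem_qualities).hasDerivWithinAt
    rwa [M.c_deriv_zero] at this
  have h := hd.isLittleO.def (c := θ / 2) (by positivity)
  filter_upwards [h] with q hq hpos
  simp only [M.c_zero, sub_zero, smul_zero, Real.norm_eq_abs] at hq
  rw [abs_of_pos hpos] at hq
  have := le_abs_self (M.c q)
  nlinarith [mul_pos hθ hpos]

lemma exists_c_lt {θ : ℝ} (hθ : 0 < θ) : ∃ q ∈ M.qualities, M.c q < θ * q := by
  have h := M.eventually_c_lt hθ
  have h2 : nhdsWithin 0 (Ioc 0 M.qmax) ≤ nhdsWithin 0 M.qualities :=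
    nhdsWithin_mono _ Ioc_subset_Icc_self
  have : (nhdsWithin (0 : ℝ) (Ioc 0 M.qmax)).NeBot := by
    rw [nhdsWithin_Ioc_eq_nhdsGT M.qmax_pos]; infer_instance
  obtain ⟨q, hq, hq'⟩ := ((h.filter_mono h2).and self_mem_nhdsWithin).exists
  exact ⟨q, Ioc_subset_Icc_self hq', hq hq'.1⟩

/-! ### The type distribution -/

lemma integral_typeDist (g : ℝ → ℝ) :
    ∫ θ, g θ ∂M.typeDist = ∫ θ in M.lo..M.hi, M.f θ * g θ := by
  rw [typeDist, integral_withDensity_eq_integral_toReal_smul₀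
    ((M.f_continuousOn.aemeasurable measurableSet_Icc).ennreal_ofReal)
    (Filter.Eventually.of_forall fun _ => ENNReal.ofReal_lt_top),
    intervalIntegral.integral_of_le M.lo_lt_hi.le, ← integral_Icc_eq_integral_Ioc]
  refine setIntegral_congr_fun measurableSet_Icc fun θ hθ => ?_
  simp [ENNReal.toReal_ofReal (M.f_pos θ hθ).le]

lemma f_integrableOn : IntegrableOn M.f (Icc M.lo M.hi) :=
  M.f_continuousOn.integrableOn_Icc

instance : IsFiniteMeasure M.typeDist :=
  isFiniteMeasure_withDensity_ofReal M.f_integrableOn.2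

lemma typeDist_ac : M.typeDist ≪ volume.restrict (Icc M.lo M.hi) :=
  withDensity_absolutelyContinuous _ _

lemma ae_mem_types : ∀ᵐ θ ∂M.typeDist, θ ∈ M.types :=
  M.typeDist_ac.ae_le (ae_restrict_mem measurableSet_Icc)

lemma ae_ne (x : ℝ) : ∀ᵐ θ ∂M.typeDist, θ ≠ x :=
  M.typeDist_ac.ae_le (ae_restrict_of_ae (Measure.ae_ne volume x))

lemma F_sub {x y : ℝ} (hx : M.lo ≤ x) (hxy : x ≤ y) (hy : y ≤ M.hi) :
    M.F y - M.F x = ∫ t in x..y, M.f t := by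
  have h1 : M.F y - M.F x = M.typeDist.real (Ioc x y) := by
    have : Ioc x y = Iic y \ Iic x := by ext; simp [and_comm]
    rw [F, F, this, measureReal_sdiff (Iic_subset_Iic.2 hxy) measurableSet_Iic]
  rw [h1, ← integral_indicator_one measurableSet_Ioc, integral_typeDist,
    intervalIntegral.integral_of_le M.lo_lt_hi.le, intervalIntegral.integral_of_le hxy]
  have : (fun θ => M.f θ * (Ioc x y).indicator 1 θ) = (Ioc x y).indicator M.f := by
    ext θ; by_cases h : θ ∈ Ioc x y <;> simp [h]
  rw [this, integral_indicator measurableSet_Ioc, Measure.restrict_restrict measurableSet_Ioc,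
    inter_eq_self_of_subset_left (Ioc_subset_Ioc hx hy)]

/-! ### Incentive compatible schemes -/

/-- A quality scheme is incentive compatible if no type prefers the quality of another type, paid as
its own quality, nor quality zero. -/
structure IncentiveCompatible (q : ℝ → ℝ) : Prop where
  mem : ∀ θ ∈ M.types, q θ ∈ M.qualities
  ic : ∀ θ ∈ M.types, ∀ θ' ∈ M.types, θ * q θ' - M.c (q θ') ≤ θ * q θ - M.c (q θ)
  ir : ∀ θ ∈ M.types, 0 ≤ θ * q θ - M.c (q θ)

variable {M}

/-- On-path beliefs are supported on the senders' qualities, which all coincide, so the wage of each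
type is its own quality and mimicking another type means getting that type's quality as wage. -/
theorem Implements.incentiveCompatible {S : Type} {π : ℝ → S} {q : ℝ → ℝ}
    (h : M.Implements π q) : M.IncentiveCompatible q := by
  obtain ⟨takes, belief, wage, h⟩ := h
  -- With equal wages, each type's optimality makes its cost no larger than the other's; `c` is
  -- injective.
  have same : ∀ θ ∈ M.types, ∀ θ' ∈ M.types,
      signal π (takes θ') (q θ') = signal π (takes θ) (q θ) → q θ' = q θ := by
    intro θ hθ θ' hθ' hs
    have h1 := h.optimal θ hθ (q θ') (h.mem_qualities θ' hθ') (takes θ')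
    have h2 := h.optimal θ' hθ' (q θ) (h.mem_qualities θ hθ) (takes θ)
    rw [hs] at h1 h2
    simp only [agentPayoff] at h1 h2
    exact M.c_strictMonoOn.injOn (h.mem_qualities θ' hθ') (h.mem_qualities θ hθ) (by linarith)
  have hw : ∀ θ ∈ M.types, wage (signal π (takes θ) (q θ)) = q θ := by
    intro θ hθ
    have := h.belief_prob (signal π (takes θ) (q θ))
    rw [h.wage_eq]
    have hae : ∀ᵐ x ∂(belief (signal π (takes θ) (q θ))), x = q θ := by
      filter_upwards [h.belief_onPath _ ⟨θ, hθ, rfl⟩] with x ⟨θ', hθ', hs, hx⟩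
      rw [← hx]
      exact same θ hθ θ' hθ' hs
    rw [integral_congr_ae hae]
    simp
  refine ⟨h.mem_qualities, fun θ hθ θ' hθ' => ?_, fun θ hθ => ?_⟩
  · have := h.optimal θ hθ (q θ') (h.mem_qualities θ' hθ') (takes θ')
    rwa [hw θ hθ, hw θ' hθ'] at this
  -- Quality zero without the test is costless and earns a nonnegative wage, whatever the belief
  -- after the null signal.
  · have := h.optimal θ hθ 0 M.zero_mem_qualities false
    rw [hw θ hθ] at this
    simp only [agentPayoff, signal, M.c_zero] at this
    have h0 : 0 ≤ wage none := by
      rw [h.wage_eq]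
      exact integral_nonneg_of_ae (h.belief_null.mono fun x hx => hx.1)
    have := mul_nonneg (M.types_nonneg hθ) h0
    simp at *
    linarith

/-- A scheme is implementable if the market's expectation of quality, as a function `w` of the
score, is correct on path, attributes to each score a quality with this score, and makes the scheme
optimal. -/
theorem implements_of_wage {S : Type} {π : ℝ → S} {q : ℝ → ℝ} (w : S → ℝ) (hq : Measurable q)
    (hmem : ∀ θ ∈ M.types, q θ ∈ M.qualities) (hw : ∀ θ ∈ M.types, w (π (q θ)) = q θ)
    (hscore : ∀ x ∈ M.qualities, w (π x) ∈ M.qualities ∧ π (w (π x)) = π x)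
    (hopt : ∀ θ ∈ M.types, ∀ x ∈ M.qualities,
      θ * w (π x) - M.c x ≤ θ * q θ - M.c (q θ))
    (hir : ∀ θ ∈ M.types, 0 ≤ θ * q θ - M.c (q θ)) : M.Implements π q := by
  -- Everyone takes the test, beliefs are point masses at `w`, and the null signal is attributed to
  -- quality zero.
  refine ⟨fun _ => true, fun s => Measure.dirac (s.elim 0 w), fun s => s.elim 0 w, ?_⟩
  refine ⟨hmem, ?_, fun s => inferInstance, ?_, ?_, ?_, ?_, fun s => by simp⟩
  · intro θ hθ x hx t
    cases t
    · have := hir θ hθ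
      have := M.c_nonneg hx
      simp only [agentPayoff, signal, if_true, Option.elim, hw θ hθ]
      simp
      linarith
    · simp only [agentPayoff, signal, if_true, Option.elim, hw θ hθ]
      exact hopt θ hθ x hx
  · rintro _ ⟨x, hx, rfl⟩
    rw [ae_dirac_eq]
    exact hscore x hx
  · rw [ae_dirac_eq]
    exact M.zero_mem_qualities
  · rintro s ⟨θ, hθ, rfl⟩
    rw [ae_dirac_eq]
    exact ⟨θ, hθ, rfl, (hw θ hθ).symm⟩
  · intro B A hA hB
    set T := {θ | θ ∈ M.types ∧ signal π true (q θ) ∈ B} with hT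
    have : ∀ θ ∈ T, Measure.dirac ((signal π true (q θ)).elim 0 w) A
        = (q ⁻¹' A).indicator 1 θ := by
      intro θ hθ
      simp only [signal, if_true, Option.elim, hw θ hθ.1]
      rw [Measure.dirac_apply' _ hA]
      rfl
    rw [setLIntegral_congr_fun hB this, lintegral_indicator_one (hq hA),
      Measure.restrict_apply (hq hA), inter_comm]
    rfl

end RatingModel

/-! ### Comparison of the principal's payoffs across incentive compatible schemes. -/

namespace RatingModel

variable {M : RatingModel} {v : ℝ → ℝ → ℝ} {α : ℝ} {β d : ℝ → ℝ}

namespace IncentiveCompatible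

variable {q q₁ q₂ : ℝ → ℝ}

/-- Indirect utility is convex, with quality as its subgradient. -/
lemma subgradient (h : M.IncentiveCompatible q) {x y : ℝ} (hx : x ∈ M.types) (hy : y ∈ M.types) :
    (y - x) * q x ≤ (y * q y - M.c (q y)) - (x * q x - M.c (q x)) := by
  have := h.ic y hy x hx
  linarith

lemma monotoneOn (h : M.IncentiveCompatible q) : MonotoneOn q M.types := by
  intro x hx y hy hxy
  rcases hxy.eq_or_lt with rfl | hlt
  · exact le_rfl
  · have h1 := h.subgradient hx hy
    have h2 := h.subgradient hy hx
    nlinarith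

lemma c_comp_monotoneOn (h : M.IncentiveCompatible q) :
    MonotoneOn (fun θ => M.c (q θ)) M.types := fun _ hx _ hy hxy =>
  M.c_strictMonoOn.monotoneOn (h.mem _ hx) (h.mem _ hy) (h.monotoneOn hx hy hxy)

lemma principalPayoff_eq (h : M.IncentiveCompatible q) (hLD : M.LinearDelegation v α β d) :
    M.principalPayoff v q
      = ∫ θ, (β θ * q θ - α * M.c (q θ) + d θ) ∂M.typeDist :=
  integral_congr_ae (M.ae_mem_types.mono fun θ hθ => hLD.eq _ (h.mem θ hθ) θ hθ)

lemma intervalIntegrable (h : M.IncentiveCompatible q) (hLD : M.LinearDelegation v α β d) :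
    IntervalIntegrable (fun θ => M.f θ * (β θ * q θ - α * M.c (q θ) + d θ)) volume M.lo M.hi := by
  have hu : uIcc M.lo M.hi = M.types := uIcc_of_le M.lo_lt_hi.le
  have h1 : IntervalIntegrable q volume M.lo M.hi :=
    MonotoneOn.intervalIntegrable (by rw [hu]; exact h.monotoneOn)
  have h2 : IntervalIntegrable (fun θ => M.c (q θ)) volume M.lo M.hi :=
    MonotoneOn.intervalIntegrable (by rw [hu]; exact h.c_comp_monotoneOn)
  have hd : IntervalIntegrable d volume M.lo M.hi :=
    ContinuousOn.intervalIntegrable (by rw [hu]; exact hLD.d_continuousOn)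
  exact (((h1.continuousOn_mul (by rw [hu]; exact hLD.beta_continuousOn)).sub
    (h2.const_mul α)).add hd).continuousOn_mul (by rw [hu]; exact M.f_continuousOn)

/-- The difference of the principal's payoffs of two schemes in terms of the differences of
qualities and of indirect utilities. -/
lemma principalPayoff_sub (h₁ : M.IncentiveCompatible q₁) (h₂ : M.IncentiveCompatible q₂)
    (hLD : M.LinearDelegation v α β d) :
    M.principalPayoff v q₂ - M.principalPayoff v q₁ = ∫ θ in M.lo..M.hi,
      ((β θ - α * θ) * M.f θ * (q₂ θ - q₁ θ) +
        α * (((θ * q₂ θ - M.c (q₂ θ)) - (θ * q₁ θ - M.c (q₁ θ))) * M.f θ)) := by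
  rw [h₁.principalPayoff_eq hLD, h₂.principalPayoff_eq hLD, integral_typeDist, integral_typeDist,
    ← intervalIntegral.integral_sub (h₂.intervalIntegrable hLD) (h₁.intervalIntegrable hLD)]
  -- Substituting `-c(q) = U - θ q` turns the cost term into `α U` and shifts `β` to `β - αθ`.
  exact intervalIntegral.integral_congr fun θ _ => by ring

lemma integrand_sub_intervalIntegrable (h₁ : M.IncentiveCompatible q₁)
    (h₂ : M.IncentiveCompatible q₂) (hLD : M.LinearDelegation v α β d) :
    IntervalIntegrable (fun θ => (β θ - α * θ) * M.f θ * (q₂ θ - q₁ θ) +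
        α * (((θ * q₂ θ - M.c (q₂ θ)) - (θ * q₁ θ - M.c (q₁ θ))) * M.f θ)) volume M.lo M.hi :=
  ((h₂.intervalIntegrable hLD).sub (h₁.intervalIntegrable hLD)).congr fun θ _ => by
    ring

/-- This is used on each side of the mode separately, where `r` is monotone and `G` can be `r` or
`-r`. Only increments of `r` enter, so `θ₀` is irrelevant. -/
lemma boundary_le_integral (h₁ : M.IncentiveCompatible q₁) (h₂ : M.IncentiveCompatible q₂)
    (hLD : M.LinearDelegation v α β d) (θ₀ : ℝ) {a b : ℝ} (ha : a ∈ M.types) (hb : b ∈ M.types)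
    (hab : a ≤ b) {G : ℝ → ℝ}
    (hG : ∀ x y, a ≤ x → x ≤ y → y ≤ b → |M.r α β θ₀ y - M.r α β θ₀ x| ≤ G y - G x)
    (hsign : ∀ x y, a ≤ x → x ≤ y → y ≤ b → (M.r α β θ₀ y - M.r α β θ₀ x) *
      ((x * q₂ x - M.c (q₂ x)) - (x * q₁ x - M.c (q₁ x))) ≤ 0) :
    (β b - α * b) * M.f b * ((b * q₂ b - M.c (q₂ b)) - (b * q₁ b - M.c (q₁ b))) -
      (β a - α * a) * M.f a * ((a * q₂ a - M.c (q₂ a)) - (a * q₁ a - M.c (q₁ a))) ≤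
    ∫ θ in a..b, ((β θ - α * θ) * M.f θ * (q₂ θ - q₁ θ) +
        α * (((θ * q₂ θ - M.c (q₂ θ)) - (θ * q₁ θ - M.c (q₁ θ))) * M.f θ)) := by
  have hsub : Icc a b ⊆ M.types := Icc_subset_Icc ha.1 hb.2
  obtain ⟨C, hC⟩ := isCompact_Icc.exists_bound_of_continuousOn M.f_continuousOn
  have hint : ∀ x y, a ≤ x → x ≤ y → y ≤ b → IntervalIntegrable q₁ volume x y ∧
      IntervalIntegrable q₂ volume x y := fun x y hx hxy hy => by
    have : uIcc x y ⊆ M.types := by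
      rw [uIcc_of_le hxy]; exact (Icc_subset_Icc hx hy).trans hsub
    exact ⟨(h₁.monotoneOn.mono this).intervalIntegrable,
      (h₂.monotoneOn.mono this).intervalIntegrable⟩
  refine _root_.boundary_le_integral (p := fun θ => (β θ - α * θ) * M.f θ) (s := M.r α β θ₀)
    (g := fun θ => q₂ θ - q₁ θ)
    (δ := fun θ => (θ * q₂ θ - M.c (q₂ θ)) - (θ * q₁ θ - M.c (q₁ θ)))
    (F := M.F) (f := M.f) (K := M.qmax) (C := C) (G := G) hab hLD.alpha_nonneg ?_ ?_ ?_
    (M.f_continuousOn.mono hsub) ?_ ?_ ?_ ?_ hG hsign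
  · intro x hx y hy
    simp only [r, density]
    rw [indicator_of_mem (show x ∈ Icc M.lo M.hi from hsub hx),
      indicator_of_mem (show y ∈ Icc M.lo M.hi from hsub hy)]
    ring
  · exact fun x y hx hxy hy => M.F_sub (ha.1.trans hx) hxy (hy.trans hb.2)
  · intro x y hx hxy hy
    have hs : Icc x y ⊆ M.types := (Icc_subset_Icc hx hy).trans hsub
    rw [intervalIntegral.integral_sub (hint x y hx hxy hy).2 (hint x y hx hxy hy).1,
      ← sub_eq_integral_of_subgradient (U := fun θ => θ * q₂ θ - M.c (q₂ θ)) hxy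
        (fun s hs' t ht => h₂.subgradient (hs hs') (hs ht)) (h₂.monotoneOn.mono hs),
      ← sub_eq_integral_of_subgradient (U := fun θ => θ * q₁ θ - M.c (q₁ θ)) hxy
        (fun s hs' t ht => h₁.subgradient (hs hs') (hs ht)) (h₁.monotoneOn.mono hs)]
    ring
  · exact fun x hx => ⟨(M.f_pos x (hsub hx)).le, (le_abs_self _).trans (hC x (hsub hx))⟩
  · exact ((hLD.beta_continuousOn.mono hsub).sub (by fun_prop)).mul (M.f_continuousOn.mono hsub)
  · exact (hint a b le_rfl hab le_rfl).2.sub (hint a b le_rfl hab le_rfl).1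
  · intro x hx
    have m1 := h₁.mem x (hsub hx)
    have m2 := h₂.mem x (hsub hx)
    exact abs_sub_le_of_nonneg_of_le m2.1 m2.2 m1.1 m1.2

/-- If `r` is unimodal, the principal gains from a rotation of the indirect utility at the mode that
lowers it to the left and raises it to the right. -/
theorem principalPayoff_le (h₁ : M.IncentiveCompatible q₁) (h₂ : M.IncentiveCompatible q₂)
    (hLD : M.LinearDelegation v α β d) (θ₀ : ℝ) {m : ℝ} (hm : m ∈ M.types)
    (hmono : MonotoneOn (M.r α β θ₀) (M.types ∩ Iic m))
    (hanti : AntitoneOn (M.r α β θ₀) (M.types ∩ Ici m))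
    (hle : ∀ θ ∈ M.types, θ ≤ m → θ * q₂ θ - M.c (q₂ θ) ≤ θ * q₁ θ - M.c (q₁ θ))
    (hge : ∀ θ ∈ M.types, m ≤ θ → θ * q₁ θ - M.c (q₁ θ) ≤ θ * q₂ θ - M.c (q₂ θ)) :
    M.principalPayoff v q₁ ≤ M.principalPayoff v q₂ := by
  have hL := h₁.boundary_le_integral h₂ hLD θ₀ M.lo_mem_types hm hm.1 (G := M.r α β θ₀)
    (fun x y hx hxy hy => by
      rw [abs_of_nonneg (sub_nonneg.2 (hmono ⟨⟨hx, (hxy.trans hy).trans hm.2⟩, hxy.trans hy⟩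
        ⟨⟨hx.trans hxy, hy.trans hm.2⟩, hy⟩ hxy))])
    (fun x y hx hxy hy => mul_nonpos_of_nonneg_of_nonpos
      (sub_nonneg.2 (hmono ⟨⟨hx, (hxy.trans hy).trans hm.2⟩, hxy.trans hy⟩
        ⟨⟨hx.trans hxy, hy.trans hm.2⟩, hy⟩ hxy))
      (sub_nonpos.2 (hle x ⟨hx, (hxy.trans hy).trans hm.2⟩ (hxy.trans hy))))
  have hR := h₁.boundary_le_integral h₂ hLD θ₀ hm M.hi_mem_types hm.2
    (G := fun θ => -M.r α β θ₀ θ)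
    (fun x y hx hxy hy => by
      have := hanti ⟨⟨hm.1.trans hx, hxy.trans hy⟩, hx⟩
        ⟨⟨hm.1.trans (hx.trans hxy), hy⟩, hx.trans hxy⟩ hxy
      rw [abs_of_nonpos (sub_nonpos.2 this)]
      linarith)
    (fun x y hx hxy hy => mul_nonpos_of_nonpos_of_nonneg
      (sub_nonpos.2 (hanti ⟨⟨hm.1.trans hx, hxy.trans hy⟩, hx⟩
        ⟨⟨hm.1.trans (hx.trans hxy), hy⟩, hx.trans hxy⟩ hxy))
      (sub_nonneg.2 (hge x ⟨hm.1.trans hx, hxy.trans hy⟩ hx)))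
  have hp : ∀ θ ∈ M.types, 0 ≤ (β θ - α * θ) * M.f θ := fun θ hθ =>
    mul_nonneg (sub_nonneg.2 (hLD.downward_bias θ hθ)) (M.f_pos θ hθ).le
  have hlo := mul_nonpos_of_nonneg_of_nonpos (hp _ M.lo_mem_types)
    (sub_nonpos.2 (hle _ M.lo_mem_types hm.1))
  have hhi := mul_nonneg (hp _ M.hi_mem_types) (sub_nonneg.2 (hge _ M.hi_mem_types hm.2))
  -- The mode is indifferent, so the two inner boundary terms vanish.
  have hmm : (m * q₂ m - M.c (q₂ m)) - (m * q₁ m - M.c (q₁ m)) = 0 :=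
    sub_eq_zero.2 (le_antisymm (hle m hm le_rfl) (hge m hm le_rfl))
  rw [hmm, mul_zero] at hL hR
  have hi := h₁.integrand_sub_intervalIntegrable h₂ hLD
  have hu : uIcc M.lo M.hi = M.types := uIcc_of_le M.lo_lt_hi.le
  have hadd := intervalIntegral.integral_add_adjacent_intervals (b := m)
    (hi.mono_set (by rw [hu, uIcc_of_le hm.1]; exact Icc_subset_Icc le_rfl hm.2))
    (hi.mono_set (by rw [hu, uIcc_of_le hm.2]; exact Icc_subset_Icc hm.1 le_rfl))
  rw [← h₁.principalPayoff_sub h₂ hLD] at hadd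
  linarith

/-- The minimum standard at which the type `m` is indifferent between the standard and the scheme
`q`. -/
lemma exists_indifferent_standard (h : M.IncentiveCompatible q) {m : ℝ} (hm : m ∈ M.types) :
    ∃ q₀ ∈ M.qualities, q m ≤ q₀ ∧ m * q₀ - M.c q₀ = m * q m - M.c (q m) ∧
      ∀ x ∈ M.qualities, q₀ ≤ x → m * x - M.c x ≤ m * q₀ - M.c q₀ := by
  have hcont : ContinuousOn (fun x => m * x - M.c x) M.qualities :=
    (by fun_prop : Continuous fun x : ℝ => m * x).continuousOn.sub M.c_continuousOn
  have hcl : IsClosed {x ∈ M.qualities | m * q m - M.c (q m) ≤ m * x - M.c x} :=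
    isClosed_Icc.isClosed_le continuousOn_const hcont
  -- The greatest quality that type `m` likes at least as much as `q m`. Indifference follows from
  -- the intermediate value theorem, as `qmax` costs even the highest type at least its worth.
  obtain ⟨q₀, hq₀, hmax⟩ := (M.isCompact_qualities.of_isClosed_subset hcl
    (fun x hx => hx.1)).exists_isGreatest ⟨q m, h.mem m hm, le_rfl⟩
  have heq : m * q₀ - M.c q₀ = m * q m - M.c (q m) := by
    refine le_antisymm ?_ hq₀.2
    have hend : m * M.qmax - M.c M.qmax ≤ m * q m - M.c (q m) := by
      have := h.ir m hm
      have := M.qmax_large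
      have := mul_le_mul_of_nonneg_right hm.2 M.qmax_pos.le
      linarith
    obtain ⟨x, hx, hxe⟩ := intermediate_value_Icc' hq₀.1.2
      (hcont.mono (Icc_subset_Icc hq₀.1.1 le_rfl)) ⟨hend, hq₀.2⟩
    have hxq : x ≤ q₀ := hmax ⟨⟨hq₀.1.1.trans hx.1, hx.2⟩, hxe.ge⟩
    rw [le_antisymm hxq hx.1] at hxe
    exact hxe.le
  refine ⟨q₀, hq₀.1, hmax ⟨h.mem m hm, le_rfl⟩, heq, fun x hx hle => ?_⟩
  rw [heq]
  by_contra! hlt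
  have : x = q₀ := le_antisymm (hmax ⟨hx, hlt.le⟩) hle
  rw [this, heq] at hlt
  exact lt_irrefl _ hlt

/-- Replacing a scheme by one with a minimum standard at which the mode of `r` is indifferent is
good for the principal. -/
theorem principalPayoff_le_of_standard (h₁ : M.IncentiveCompatible q₁)
    (h₂ : M.IncentiveCompatible q₂)
    (hLD : M.LinearDelegation v α β d) (θ₀ : ℝ) {m q₀ : ℝ} (hm : m ∈ M.types)
    (hmono : MonotoneOn (M.r α β θ₀) (M.types ∩ Iic m))
    (hanti : AntitoneOn (M.r α β θ₀) (M.types ∩ Ici m)) (hq₀ : q₀ ∈ M.qualities)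
    (hge : q₁ m ≤ q₀) (heq : m * q₀ - M.c q₀ = m * q₁ m - M.c (q₁ m))
    (hmax : ∀ x ∈ M.qualities, q₀ ≤ x → m * x - M.c x ≤ m * q₀ - M.c q₀)
    (hstd : ∀ θ ∈ M.types, q₂ θ = 0 ∨ q₀ ≤ q₂ θ)
    (hopt : ∀ θ ∈ M.types, m ≤ θ → ∀ x ∈ M.qualities, q₀ ≤ x →
      θ * x - M.c x ≤ θ * q₂ θ - M.c (q₂ θ)) :
    M.principalPayoff v q₁ ≤ M.principalPayoff v q₂ := by
  refine h₁.principalPayoff_le h₂ hLD θ₀ hm hmono hanti ?_ ?_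
  · intro θ hθ hle
    rcases hstd θ hθ with h0 | hs
    · rw [h0, M.c_zero]
      have := h₁.ir θ hθ
      linarith
    -- Type `m` does not gain from `q₂ θ`, and passing from `m` down to `θ` costs at least as much
    -- utility at `q₂ θ` as at the smaller `q₁ m`.
    · have e1 := hmax _ (h₂.mem θ hθ) hs
      have e2 := h₁.subgradient hm hθ
      nlinarith
  · intro θ hθ hle
    rcases le_total q₀ (q₁ θ) with h | h
    · exact hopt θ hθ hle _ (h₁.mem θ hθ) h
    -- From the common utility at `m`, the payoff from `q₀` rises with slope `q₀ ≥ q₁ θ`, and `U`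
    -- under `q₁` rises by at most `(θ - m) * q₁ θ`.
    · have e1 := hopt θ hθ hle q₀ hq₀ le_rfl
      have e2 := h₁.subgradient hθ hm
      nlinarith

end IncentiveCompatible
end RatingModel

/-! ### Schemes with a minimum standard and existence of a best standard. -/

namespace RatingModel

variable {M : RatingModel} {v : ℝ → ℝ → ℝ} {α : ℝ} {β d : ℝ → ℝ}

/-- If all types choose the best quality from a menu that contains `0`, the scheme is incentive
compatible. -/
lemma incentiveCompatible_of_menu {D : Set ℝ} {q : ℝ → ℝ} (hD : D ⊆ M.qualities) (h0 : 0 ∈ D)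
    (hq : ∀ θ, q θ ∈ D)
    (hopt : ∀ θ ∈ M.types, ∀ x ∈ D, θ * x - M.c x ≤ θ * q θ - M.c (q θ)) :
    M.IncentiveCompatible q :=
  ⟨fun θ _ => hD (hq θ), fun θ hθ θ' _ => hopt θ hθ _ (hq θ'), fun θ hθ => by
    simpa [M.c_zero] using hopt θ hθ 0 h0⟩

variable (M) in
/-- The scheme in which types below the cutoff type of `q₀` choose quality `0`, and the other types
choose `h q₀ θ`. -/
noncomputable def standardScheme (h : ℝ → ℝ → ℝ) (q₀ θ : ℝ) : ℝ :=
  -- Indifferent types meet the standard; in particular `q₀ = 0` excludes nobody.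
  open Classical in if θ * q₀ < M.c q₀ then 0 else h q₀ θ

lemma standardScheme_of_lt {h : ℝ → ℝ → ℝ} {q₀ θ : ℝ} (hlt : θ * q₀ < M.c q₀) :
    M.standardScheme h q₀ θ = 0 := if_pos hlt

lemma standardScheme_of_le {h : ℝ → ℝ → ℝ} {q₀ θ : ℝ} (hle : M.c q₀ ≤ θ * q₀) :
    M.standardScheme h q₀ θ = h q₀ θ := if_neg hle.not_gt

lemma measurable_standardScheme {h : ℝ → ℝ → ℝ} {q₀ : ℝ} (hh : Measurable (h q₀)) :
    Measurable (M.standardScheme h q₀) := by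
  exact Measurable.ite (measurableSet_lt (measurable_id'.mul_const q₀) measurable_const)
    measurable_const hh

/-- The scheme of almost every type is continuous in the minimum standard. -/
lemma continuousWithinAt_standardScheme {h : ℝ → ℝ → ℝ} {q₀ θ : ℝ} (hθ : 0 < θ)
    (hne : θ ≠ M.c q₀ / q₀) (hh : ContinuousWithinAt (fun x => h x θ) M.qualities q₀)
    (hq₀ : q₀ ∈ M.qualities) :
    ContinuousWithinAt (fun x => M.standardScheme h x θ) M.qualities q₀ := by
  have hmul : ContinuousWithinAt (fun x => θ * x) M.qualities q₀ :=
    (by fun_prop : Continuous fun x : ℝ => θ * x).continuousWithinAt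
  have hc := M.c_continuousOn q₀ hq₀
  have key : M.c q₀ ≤ θ * q₀ → (∀ᶠ x in nhdsWithin q₀ M.qualities, M.c x ≤ θ * x) →
      ContinuousWithinAt (fun x => M.standardScheme h x θ) M.qualities q₀ := fun hle hev =>
    hh.congr_of_eventuallyEq (hev.mono fun x hx => standardScheme_of_le hx)
      (standardScheme_of_le hle)
  rcases lt_trichotomy (θ * q₀) (M.c q₀) with hlt | heq | hgt
  · exact continuousWithinAt_const.congr_of_eventuallyEq
      ((hmul.eventually_lt hc hlt).mono fun x hx => standardScheme_of_lt hx)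
      (standardScheme_of_lt hlt)
  -- A tie at positive `q₀` occurs only for the cutoff type. At `q₀ = 0` every type ties, but a
  -- positive type meets all small standards since `c'(0) = 0`.
  · have h0 : q₀ = 0 := by
      by_contra h0
      exact hne (by rw [← heq, mul_div_cancel_right₀ _ h0])
    refine key heq.ge ?_
    rw [h0]
    filter_upwards [M.eventually_c_lt hθ, self_mem_nhdsWithin] with x hx hxQ
    rcases hxQ.1.eq_or_lt with rfl | hpos
    · simp [M.c_zero]
    · exact (hx hpos).le
  · exact key hgt.le ((hc.eventually_lt hmul hgt).mono fun x hx => hx.le)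

/-- The principal's payoff is continuous in the minimum standard. -/
theorem continuousOn_principalPayoff_standardScheme (hLD : M.LinearDelegation v α β d)
    {h : ℝ → ℝ → ℝ} (hh : ∀ θ, ContinuousOn (fun x => h x θ) M.qualities)
    (hic : ∀ q₀ ∈ M.qualities, M.IncentiveCompatible (M.standardScheme h q₀)) :
    ContinuousOn (fun q₀ => M.principalPayoff v (M.standardScheme h q₀)) M.qualities := by
  intro q₀ hq₀
  obtain ⟨B, hB⟩ := isCompact_Icc.exists_bound_of_continuousOn hLD.beta_continuousOn
  obtain ⟨C, hC⟩ := isCompact_Icc.exists_bound_of_continuousOn hLD.d_continuousOn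
  have hα := hLD.alpha_nonneg
  have hcont : ContinuousWithinAt (fun q₀ => ∫ θ, (β θ * M.standardScheme h q₀ θ -
      α * M.c (M.standardScheme h q₀ θ) + d θ) ∂M.typeDist) M.qualities q₀ := by
    refine continuousWithinAt_of_dominated (bound := fun _ => B * M.qmax + α * M.c M.qmax + C)
      ?_ ?_ (integrable_const _) ?_
    · filter_upwards [self_mem_nhdsWithin] with x hx
      have h1 := hic x hx
      have hm : ∀ g : ℝ → ℝ, AEMeasurable g (volume.restrict (Icc M.lo M.hi)) →
          AEMeasurable g M.typeDist := fun g hg => hg.mono_ac M.typeDist_ac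
      have m1 := hm _ (aemeasurable_restrict_of_monotoneOn measurableSet_Icc h1.monotoneOn)
      have m2 := hm _ (aemeasurable_restrict_of_monotoneOn measurableSet_Icc h1.c_comp_monotoneOn)
      have m3 := hm _ (ContinuousOn.aemeasurable hLD.beta_continuousOn measurableSet_Icc)
      have m4 := hm _ (ContinuousOn.aemeasurable hLD.d_continuousOn measurableSet_Icc)
      exact (((m3.mul m1).sub (m2.const_mul α)).add m4).aestronglyMeasurable
    · filter_upwards [self_mem_nhdsWithin] with x hx
      filter_upwards [M.ae_mem_types] with θ hθ
      have hq := (hic x hx).mem θ hθ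
      have b1 : |β θ * M.standardScheme h x θ| ≤ B * M.qmax := by
        rw [abs_mul, abs_of_nonneg hq.1]
        exact mul_le_mul (hB θ hθ) hq.2 hq.1 ((norm_nonneg _).trans (hB θ hθ))
      have b2 : |α * M.c (M.standardScheme h x θ)| ≤ α * M.c M.qmax := by
        rw [abs_of_nonneg (mul_nonneg hα (M.c_nonneg hq))]
        exact mul_le_mul_of_nonneg_left
          (M.c_strictMonoOn.monotoneOn hq M.qmax_mem_qualities hq.2) hα
      have b3 : |d θ| ≤ C := hC θ hθ
      rw [Real.norm_eq_abs, abs_le]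
      have := abs_le.1 b1
      have := abs_le.1 b2
      have := abs_le.1 b3
      constructor <;> linarith
    -- The two types at which continuity may fail form a null set.
    · filter_upwards [M.ae_mem_types, M.ae_ne 0, M.ae_ne (M.c q₀ / q₀)] with θ hθ h0 hne
      have hs := continuousWithinAt_standardScheme
        (lt_of_le_of_ne (M.types_nonneg hθ) (Ne.symm h0)) hne (hh θ q₀ hq₀) hq₀
      have hcs : ContinuousWithinAt (fun x => M.c (M.standardScheme h x θ)) M.qualities q₀ :=
        ContinuousWithinAt.comp (t := M.qualities) (M.c_continuousOn _ ((hic q₀ hq₀).mem θ hθ)) hs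
          fun x hx => (hic x hx).mem θ hθ
      exact ((hs.const_mul _).sub (hcs.const_mul _)).add continuousWithinAt_const
  exact hcont.congr (fun x hx => (hic x hx).principalPayoff_eq hLD)
    ((hic q₀ hq₀).principalPayoff_eq hLD)

/-- An optimal minimum standard exists in a compact set of standards, if each implementable scheme
is dominated by one of them. -/
theorem exists_isOptimalRating (hLD : M.LinearDelegation v α β d) {h : ℝ → ℝ → ℝ}
    (hh : ∀ θ, ContinuousOn (fun x => h x θ) M.qualities)
    (hic : ∀ q₀ ∈ M.qualities, M.IncentiveCompatible (M.standardScheme h q₀))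
    {K : Set ℝ} (hK : IsClosed K) (hKQ : K ⊆ M.qualities) {S : Type} (π : ℝ → ℝ → S)
    (himp : ∀ q₀ ∈ K, M.Implements (π q₀) (M.standardScheme h q₀))
    (hdom : ∀ q, M.IncentiveCompatible q →
      ∃ q₀ ∈ K, M.principalPayoff v q ≤ M.principalPayoff v (M.standardScheme h q₀)) :
    ∃ q₀ ∈ K, M.IsOptimalRating v (π q₀) (M.standardScheme h q₀) := by
  have hne : K.Nonempty := by
    obtain ⟨q₀, hq₀, _⟩ := hdom _ (hic 0 M.zero_mem_qualities)
    exact ⟨q₀, hq₀⟩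
  obtain ⟨q₀, hq₀, hmax⟩ := (M.isCompact_qualities.of_isClosed_subset hK hKQ).exists_isMaxOn hne
    ((continuousOn_principalPayoff_standardScheme hLD hh hic).mono hKQ)
  refine ⟨q₀, hq₀, himp q₀ hq₀, fun S' π' q' hq' => ?_⟩
  obtain ⟨x, hx, hle⟩ := hdom q' hq'.incentiveCompatible
  exact hle.trans (hmax hx)

/-! ### Pass/fail tests -/

variable (M) in
/-- The scheme implemented by the pass/fail test with minimum standard `q₀`. -/
noncomputable def passFailScheme (q₀ : ℝ) : ℝ → ℝ := M.standardScheme (fun x _ => x) q₀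

lemma passFailScheme_mem (q₀ θ : ℝ) : M.passFailScheme q₀ θ ∈ ({0, q₀} : Set ℝ) := by
  rcases lt_or_ge (θ * q₀) (M.c q₀) with hlt | hle
  · exact Or.inl (standardScheme_of_lt hlt)
  · exact Or.inr (standardScheme_of_le hle)

lemma le_passFailScheme (q₀ θ : ℝ) {x : ℝ} (hx : x ∈ ({0, q₀} : Set ℝ)) :
    θ * x - M.c x ≤ θ * M.passFailScheme q₀ θ - M.c (M.passFailScheme q₀ θ) := by
  rcases lt_or_ge (θ * q₀) (M.c q₀) with hlt | hle
  · rw [passFailScheme, standardScheme_of_lt hlt]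
    rcases hx with rfl | rfl
    · exact le_rfl
    · rw [M.c_zero]; linarith
  · rw [passFailScheme, standardScheme_of_le hle]
    rcases hx with rfl | rfl
    · rw [M.c_zero]; linarith
    · exact le_rfl

lemma incentiveCompatible_passFailScheme {q₀ : ℝ} (hq₀ : q₀ ∈ M.qualities) :
    M.IncentiveCompatible (M.passFailScheme q₀) :=
  incentiveCompatible_of_menu (D := {0, q₀})
    (insert_subset M.zero_mem_qualities (singleton_subset_iff.2 hq₀)) (Or.inl rfl)
    (passFailScheme_mem q₀) fun θ _ _ hx => le_passFailScheme q₀ θ hx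

theorem implements_passFail {q₀ : ℝ} (hq₀ : q₀ ∈ M.qualities) :
    M.Implements (passFail q₀) (M.passFailScheme q₀) := by
  have hic := M.incentiveCompatible_passFailScheme hq₀
  have ht : ∀ {x}, q₀ ≤ x → passFail q₀ x = true := fun h => by simp [passFail, h]
  have hf : ∀ {x}, x < q₀ → passFail q₀ x = false := fun h => by simp [passFail, h]
  -- Each score is attributed to the cheapest quality that earns it. If `q₀ = 0`, no feasible
  -- quality fails.
  refine implements_of_wage (fun s => if s then q₀ else 0) (measurable_standardScheme
    measurable_const) hic.mem ?_ ?_ ?_ hic.ir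
  · intro θ _
    rcases passFailScheme_mem (M := M) q₀ θ with h0 | h1
    · rw [h0]
      rcases hq₀.1.eq_or_lt with h | h
      · simp [← h]
      · simp [hf h]
    · rw [mem_singleton_iff.1 h1]
      simp [ht le_rfl]
  · intro x hx
    rcases le_or_gt q₀ x with h | h
    · simp [ht h, ht le_rfl, hq₀]
    · simp [hf h, hf (hx.1.trans_lt h), M.zero_mem_qualities]
  · intro θ hθ x hx
    rcases le_or_gt q₀ x with h | h
    · have := le_passFailScheme (M := M) q₀ θ (x := q₀) (Or.inr rfl)
      have := M.c_strictMonoOn.monotoneOn hq₀ hx h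
      simp only [ht h, if_true]
      linarith
    · have := hic.ir θ hθ
      have := M.c_nonneg hx
      simp [hf h]
      linarith

/-! ### Lower censorship -/

variable (M) in
lemma exists_fullDisclosure (θ : ℝ) :
    ∃ q ∈ M.qualities, ∀ x ∈ M.qualities, θ * x - M.c x ≤ θ * q - M.c q :=
  M.isCompact_qualities.exists_isMaxOn ⟨0, M.zero_mem_qualities⟩
    ((by fun_prop : Continuous fun x : ℝ => θ * x).continuousOn.sub M.c_continuousOn)

variable (M) in
/-- A scheme implemented by full disclosure. -/
noncomputable def fullDisclosureScheme (θ : ℝ) : ℝ := (M.exists_fullDisclosure θ).choose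

lemma fullDisclosureScheme_mem (θ : ℝ) : M.fullDisclosureScheme θ ∈ M.qualities :=
  (M.exists_fullDisclosure θ).choose_spec.1

lemma le_fullDisclosureScheme (θ : ℝ) {x : ℝ} (hx : x ∈ M.qualities) :
    θ * x - M.c x ≤ θ * M.fullDisclosureScheme θ - M.c (M.fullDisclosureScheme θ) :=
  (M.exists_fullDisclosure θ).choose_spec.2 x hx

/-- The maximizers are picked by choice; monotonicity, valid for any selection by revealed
preference, supplies measurability. -/
lemma monotone_fullDisclosureScheme : Monotone M.fullDisclosureScheme := by
  intro x y hxy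
  rcases hxy.eq_or_lt with rfl | hlt
  · exact le_rfl
  · have h1 := M.le_fullDisclosureScheme x (M.fullDisclosureScheme_mem y)
    have h2 := M.le_fullDisclosureScheme y (M.fullDisclosureScheme_mem x)
    nlinarith

lemma fullDisclosureScheme_pos {θ : ℝ} (hθ : 0 < θ) : 0 < M.fullDisclosureScheme θ := by
  refine (M.fullDisclosureScheme_mem θ).1.lt_of_ne fun h => ?_
  obtain ⟨x, hx, hlt⟩ := M.exists_c_lt hθ
  have := M.le_fullDisclosureScheme θ hx
  rw [← h, M.c_zero] at this
  linarith

lemma concaveOn_payoff (θ : ℝ) : ConcaveOn ℝ M.qualities fun x => θ * x - M.c x := by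
  refine ConcaveOn.sub ⟨convex_Icc _ _, fun x _ y _ a b _ _ _ => ?_⟩ M.c_convexOn
  simp only [smul_eq_mul]
  exact le_of_eq (by ring)

variable (M) in
/-- The scheme implemented by lower censorship with minimum standard `q₀`. -/
noncomputable def lowerCensorshipScheme (q₀ : ℝ) : ℝ → ℝ :=
  M.standardScheme (fun x θ => max x (M.fullDisclosureScheme θ)) q₀

lemma lowerCensorshipScheme_eq_zero_or_le (q₀ θ : ℝ) :
    M.lowerCensorshipScheme q₀ θ = 0 ∨ q₀ ≤ M.lowerCensorshipScheme q₀ θ := by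
  rcases lt_or_ge (θ * q₀) (M.c q₀) with hlt | hle
  · exact Or.inl (standardScheme_of_lt hlt)
  · rw [lowerCensorshipScheme, standardScheme_of_le hle]
    exact Or.inr (le_max_left _ _)

lemma lowerCensorshipScheme_mem {q₀ : ℝ} (hq₀ : q₀ ∈ M.qualities) (θ : ℝ) :
    M.lowerCensorshipScheme q₀ θ ∈ M.qualities := by
  rcases lt_or_ge (θ * q₀) (M.c q₀) with hlt | hle
  · rw [lowerCensorshipScheme, standardScheme_of_lt hlt]
    exact M.zero_mem_qualities
  · rw [lowerCensorshipScheme, standardScheme_of_le hle]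
    exact ⟨hq₀.1.trans (le_max_left _ _), max_le hq₀.2 (M.fullDisclosureScheme_mem θ).2⟩

/-- By concavity, the payoff is weakly decreasing past a point no better than an earlier one. So a
type that prefers `0` to `q₀` rejects everything above `q₀`, and a type with full-disclosure quality
below `q₀` picks `q₀` itself among passing qualities. -/
lemma le_lowerCensorshipScheme {q₀ : ℝ} (hq₀ : q₀ ∈ M.qualities) (θ : ℝ) {x : ℝ}
    (hx : x ∈ M.qualities) (h : x = 0 ∨ q₀ ≤ x) :
    θ * x - M.c x
      ≤ θ * M.lowerCensorshipScheme q₀ θ - M.c (M.lowerCensorshipScheme q₀ θ) := by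
  rcases lt_or_ge (θ * q₀) (M.c q₀) with hlt | hle
  · rw [lowerCensorshipScheme, standardScheme_of_lt hlt]
    rcases h with rfl | h
    · exact le_rfl
    · have hpos : 0 < q₀ := hq₀.1.lt_of_ne fun h0 => by simp [← h0, M.c_zero] at hlt
      have := (M.concaveOn_payoff θ).right_le_of_le_left'' M.zero_mem_qualities hx hpos h
        (by simp only [M.c_zero]; linarith)
      simp only [M.c_zero]
      linarith
  · rw [lowerCensorshipScheme, standardScheme_of_le hle]
    have hge : ∀ y ∈ M.qualities, q₀ ≤ y → θ * y - M.c y ≤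
        θ * max q₀ (M.fullDisclosureScheme θ) - M.c (max q₀ (M.fullDisclosureScheme θ)) := by
      intro y hy hqy
      rcases lt_or_ge (M.fullDisclosureScheme θ) q₀ with hlt | hle
      · rw [max_eq_left hlt.le]
        exact (M.concaveOn_payoff θ).right_le_of_le_left'' (M.fullDisclosureScheme_mem θ) hy hlt
          hqy (M.le_fullDisclosureScheme θ hq₀)
      · rw [max_eq_right hle]
        exact M.le_fullDisclosureScheme θ hy
    rcases h with rfl | h
    · have := hge q₀ hq₀ le_rfl
      rw [M.c_zero]
      linarith
    · exact hge x hx h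

lemma incentiveCompatible_lowerCensorshipScheme {q₀ : ℝ} (hq₀ : q₀ ∈ M.qualities) :
    M.IncentiveCompatible (M.lowerCensorshipScheme q₀) :=
  incentiveCompatible_of_menu (D := {x ∈ M.qualities | x = 0 ∨ q₀ ≤ x}) (fun _ hx => hx.1)
    ⟨M.zero_mem_qualities, Or.inl rfl⟩
    (fun θ => ⟨lowerCensorshipScheme_mem hq₀ θ, lowerCensorshipScheme_eq_zero_or_le q₀ θ⟩)
    fun θ _ _ hx => le_lowerCensorshipScheme hq₀ θ hx.1 hx.2

theorem implements_lowerCensorship {q₀ : ℝ} (hq₀ : q₀ ∈ M.qualities) :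
    M.Implements (lowerCensorship q₀) (M.lowerCensorshipScheme q₀) := by
  have hic := M.incentiveCompatible_lowerCensorshipScheme hq₀
  have ht : ∀ {x}, q₀ ≤ x → lowerCensorship q₀ x = some x := fun h => if_pos h
  have hf : ∀ {x}, x < q₀ → lowerCensorship q₀ x = none := fun h => if_neg h.not_ge
  refine implements_of_wage (fun s => s.getD 0) (measurable_standardScheme
    (measurable_const.max M.monotone_fullDisclosureScheme.measurable)) hic.mem ?_ ?_ ?_ hic.ir
  · intro θ _
    rcases le_or_gt q₀ (M.lowerCensorshipScheme q₀ θ) with h | h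
    · simp [ht h]
    · rw [hf h]
      exact ((lowerCensorshipScheme_eq_zero_or_le q₀ θ).resolve_right h.not_ge).symm
  · intro x hx
    rcases le_or_gt q₀ x with h | h
    · simp [ht h, hx]
    · simp [hf h, hf (hx.1.trans_lt h), M.zero_mem_qualities]
  · intro θ hθ x hx
    rcases le_or_gt q₀ x with h | h
    · simpa [ht h] using le_lowerCensorshipScheme hq₀ θ hx (Or.inr h)
    · have := hic.ir θ hθ
      have := M.c_nonneg hx
      simp [hf h]
      linarith

lemma noExclusion_lowerCensorshipScheme {q₀ : ℝ} (hq₀ : q₀ ∈ M.qualities)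
    (hle : M.c q₀ ≤ M.lo * q₀) : M.NoExclusion q₀ (M.lowerCensorshipScheme q₀) := by
  refine ⟨div_le_of_le_mul₀ hq₀.1 M.lo_nonneg hle, fun θ hθ hpos => ?_⟩
  rw [lowerCensorshipScheme,
    standardScheme_of_le (hle.trans (mul_le_mul_of_nonneg_right hθ.1 hq₀.1))]
  exact lt_max_of_lt_right (fullDisclosureScheme_pos hpos)

/-- If `r` is unimodal with mode `m`, each incentive compatible scheme is dominated by lower
censorship with a minimum standard that type `m` is willing to meet. -/
lemma exists_lowerCensorshipScheme_ge (hLD : M.LinearDelegation v α β d) (θ₀ : ℝ) {m : ℝ}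
    (hm : m ∈ M.types) (hmono : MonotoneOn (M.r α β θ₀) (M.types ∩ Iic m))
    (hanti : AntitoneOn (M.r α β θ₀) (M.types ∩ Ici m)) {q : ℝ → ℝ}
    (hq : M.IncentiveCompatible q) :
    ∃ q₀ ∈ M.qualities, M.c q₀ ≤ m * q₀ ∧
      M.principalPayoff v q ≤ M.principalPayoff v (M.lowerCensorshipScheme q₀) := by
  obtain ⟨q₀, hq₀, hge, heq, hmax⟩ := hq.exists_indifferent_standard hm
  refine ⟨q₀, hq₀, by linarith [hq.ir m hm], ?_⟩
  exact hq.principalPayoff_le_of_standard (incentiveCompatible_lowerCensorshipScheme hq₀) hLD θ₀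
    hm hmono hanti hq₀ hge heq hmax (fun θ _ => lowerCensorshipScheme_eq_zero_or_le q₀ θ)
    fun θ _ _ x hx hle => le_lowerCensorshipScheme hq₀ θ hx (Or.inr hle)

end RatingModel

/-! ### The three cases, with the mode inside, at the top and at the bottom of the type space. -/

theorem mainTheorem5 (M : RatingModel) (v : ℝ → ℝ → ℝ) (α : ℝ) (β d : ℝ → ℝ)
    (hLD : M.LinearDelegation v α β d) (θ₀ : ℝ) :
    (UnimodalOn (M.r α β θ₀) M.types →
      ∃ q₀ ∈ M.qualities, ∃ q : ℝ → ℝ, M.IsOptimalRating v (lowerCensorship q₀) q) ∧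
    (MonotoneOn (M.r α β θ₀) M.types →
      ∃ q₀ ∈ M.qualities, ∃ q : ℝ → ℝ, M.IsOptimalRating v (passFail q₀) q) ∧
    (AntitoneOn (M.r α β θ₀) M.types →
      ∃ q₀ ∈ M.qualities, ∃ q : ℝ → ℝ,
        M.IsOptimalRating v (lowerCensorship q₀) q ∧ M.NoExclusion q₀ q) := by
  have hcens : ∀ θ, ContinuousOn (fun x => max x (M.fullDisclosureScheme θ)) M.qualities :=
    fun θ => (continuous_id.max continuous_const).continuousOn
  refine ⟨?_, ?_, ?_⟩
  · rintro ⟨m, hm, hmono, hanti⟩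
    obtain ⟨q₀, hq₀, hopt⟩ := RatingModel.exists_isOptimalRating hLD hcens
      (fun _ h => RatingModel.incentiveCompatible_lowerCensorshipScheme h) isClosed_Icc
      Subset.rfl lowerCensorship (fun _ h => RatingModel.implements_lowerCensorship h)
      (fun q hq => by
        obtain ⟨q₀, hq₀, -, hle⟩ :=
          RatingModel.exists_lowerCensorshipScheme_ge hLD θ₀ hm hmono hanti hq
        exact ⟨q₀, hq₀, hle⟩)
    exact ⟨q₀, hq₀, _, hopt⟩
  · intro hmono
    have hhi : ∀ θ ∈ M.types, M.hi ≤ θ → θ = M.hi := fun θ hθ h => le_antisymm hθ.2 h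
    have hanti : AntitoneOn (M.r α β θ₀) (M.types ∩ Ici M.hi) := fun x hx y hy _ => by
      rw [hhi x hx.1 hx.2, hhi y hy.1 hy.2]
    obtain ⟨q₀, hq₀, hopt⟩ := RatingModel.exists_isOptimalRating hLD
      (h := fun x _ => x) (fun _ => continuousOn_id)
      (fun _ h => RatingModel.incentiveCompatible_passFailScheme h) isClosed_Icc
      Subset.rfl passFail (fun _ h => RatingModel.implements_passFail h)
      (fun q hq => by
        obtain ⟨q₀, hq₀, hge, heq, hmax⟩ := hq.exists_indifferent_standard M.hi_mem_types
        refine ⟨q₀, hq₀, hq.principalPayoff_le_of_standard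
          (RatingModel.incentiveCompatible_passFailScheme hq₀) hLD θ₀ M.hi_mem_types
          (hmono.mono inter_subset_left) hanti hq₀ hge heq hmax
          (fun θ _ => (RatingModel.passFailScheme_mem q₀ θ).imp id fun h => h.ge) ?_⟩
        -- Only the highest type lies at or above the mode, and no quality above `q₀` is better for
        -- it than `q₀`.
        intro θ hθ h x hx hle
        rw [hhi θ hθ h]
        exact (hmax x hx hle).trans (RatingModel.le_passFailScheme q₀ M.hi (Or.inr rfl)))
    exact ⟨q₀, hq₀, _, hopt⟩
  · intro hanti
    have hmono : MonotoneOn (M.r α β θ₀) (M.types ∩ Iic M.lo) := fun x hx y hy _ => by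
      rw [le_antisymm hx.2 hx.1.1, le_antisymm hy.2 hy.1.1]
    obtain ⟨q₀, hq₀, hopt⟩ := RatingModel.exists_isOptimalRating hLD hcens
      (fun _ h => RatingModel.incentiveCompatible_lowerCensorshipScheme h)
      -- Maximizing only over the closed set of standards acceptable to the lowest type builds in
      -- the absence of exclusion.
      (K := {x ∈ M.qualities | M.c x ≤ M.lo * x})
      (isClosed_Icc.isClosed_le M.c_continuousOn (by fun_prop)) (fun _ hx => hx.1)
      lowerCensorship (fun _ h => RatingModel.implements_lowerCensorship h.1)
      (fun q hq => by
        obtain ⟨q₀, hq₀, hc, hle⟩ := RatingModel.exists_lowerCensorshipScheme_ge hLD θ₀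
          M.lo_mem_types hmono (hanti.mono inter_subset_left) hq
        exact ⟨q₀, ⟨hq₀, hc⟩, hle⟩)
    exact ⟨q₀, hq₀.1, _, hopt, RatingModel.noExclusion_lowerCensorshipScheme hq₀.1 hq₀.2⟩
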